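/- Let $\mathbb{F}_q$ be a finite field and let $n\ge 1$ with $\gcd(n,q)=1$. Let $\alpha$ be a primitive $n$-th root of unity in an extension field of $\mathbb{F}_q$. For a cyclic code $C\subseteq\mathbb{F}_q^n$ with generator polynomial $g$ (the monic generator of the ideal of $\mathbb{F}_q[x]$ generated by $x^n-1$ and the polynomials $\sum_i c_i x^i$, $c\in C$), let $Z(C)=\{i\in\{0,\dots,n-1\} : g(\alpha^i)=0\}$ be its defining set with respect to $\alpha$, and let $C^\perp$ be the dual code with respect to the Euclidean form $\sum_i x_iy_i$. An entanglement-assisted quantum (QUENTA) code with parameters $[[n,k,d;c]]_q$ is given by an isometry $V:(\mathbb{C}^q)^{\otimes k}\otimes(\mathbb{C}^q)^{\otimes c}\to(\mathbb{C}^q)^{\otimes n}$. It encodes a state $|\psi\rangle$ of $k$ logical qudits as $(V\otimes I)(|\psi\rangle\otimes|\Phi\rangle)$, where $|\Phi\rangle$ consists of $c$ maximally entangled pairs of qudits, $V$ acts on the sender's halves of these pairs, and the receiver's halves are error-free. It is required to have minimum distance at least $d$: if $P$ is the projection onto the space of encoded states, then for every operator $E$ on $(\mathbb{C}^q)^{\otimes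 n}$ that acts non-trivially on fewer than $d$ of the $n$ qudits there is $\lambda\in\mathbb{C}$ with $P(E\otimes I)P=\lambda P$ (so that $\lfloor (d-1)/2\rfloor$ errors can be corrected). If $k=0$, it is required, as usual, that this holds with $\lambda=\operatorname{tr}(E)/q^n$. **Theorem.** Let $C_1$ and $C_2$ be (nonzero) cyclic codes over $\mathbb{F}_q$ of length $n$ with parameters $[n,k_1,d_1]_q$ and $[n,k_2,d_2]_q$ (length, dimension, minimum Hamming distance). Then there is a QUENTA code with parameters $$[[\,n,\; k_1-|Z(C_1^\perp)\cap Z(C_2)|,\; \min\{d_1,d_2\};\; n-k_2-|Z(C_1^\perp)\cap Z(C_2)|\,]]_q ;$$ in particular, the second and the fourth parameter are non-negative. -/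

import Mathlib

open scoped Polynomial Matrix Kronecker

noncomputable section

namespace QUENTA

/-! ## Classical cyclic codes -/

/-- The linear code `C ⊆ F ^ n` has parameters `[n, k, d]`: dimension `k` and minimum Hamming
distance `d`. (Having a minimum distance forces `C` to be nonzero.) -/
structure HasParams {F : Type*} [Field F] [DecidableEq F] {n : ℕ}
    (C : Submodule F (Fin n → F)) (k d : ℕ) : Prop where
  finrank_eq : Module.finrank F C = k
  minDist : IsLeast {w : ℕ | ∃ x ∈ C, ∃ y ∈ C, x ≠ y ∧ hammingDist x y = w} d

/-- `C` is cyclic: `(c₀, …, cₙ₋₁) ∈ C` implies `(cₙ₋₁, c₀, …, cₙ₋₂) ∈ C`. -/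
def IsCyclic {F : Type*} [Field F] {n : ℕ} (C : Submodule F (Fin n → F)) : Prop :=
  ∀ x ∈ C, (fun i => x ((finRotate n).symm i)) ∈ C

/-- The Euclidean dual `C^⊥ = {y | ∀ x ∈ C, ∑ xᵢ yᵢ = 0}`. -/
def dual {F : Type*} [Field F] {n : ℕ} (C : Submodule F (Fin n → F)) :
    Submodule F (Fin n → F) where
  carrier := {y | ∀ x ∈ C, x ⬝ᵥ y = 0}
  add_mem' := by
    intro a b ha hb x hx
    rw [dotProduct_add, ha x hx, hb x hx, add_zero]
  zero_mem' := by
    intro x _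
    exact dotProduct_zero x
  smul_mem' := by
    intro t a ha x hx
    rw [dotProduct_smul, ha x hx, smul_zero]

/-- The polynomial `c₀ + c₁ X + ⋯ + cₙ₋₁ Xⁿ⁻¹` of a word. -/
def wordPoly {F : Type*} [Field F] {n : ℕ} (x : Fin n → F) : F[X] :=
  ∑ i : Fin n, Polynomial.C (x i) * Polynomial.X ^ (i : ℕ)

/-- The ideal of `F[X]` generated by `X ^ n - 1` and the polynomials of all codewords.
For a cyclic code `C` it is the preimage of the ideal of `F[X] / (X ^ n - 1)`
that corresponds to `C`. -/
def codeIdeal {F : Type*} [Field F] {n : ℕ} (C : Submodule F (Fin n → F)) : Ideal F[X] :=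
  Ideal.span (insert (Polynomial.X ^ n - 1) (wordPoly '' (C : Set (Fin n → F))))

/-- The generator polynomial of a cyclic code: the monic generator of its ideal
(it is `X ^ n - 1` for the zero code). -/
def generatorPoly {F : Type*} [Field F] {n : ℕ} (C : Submodule F (Fin n → F)) : F[X] :=
  Submodule.IsPrincipal.generator (codeIdeal C) *
    Polynomial.C (Submodule.IsPrincipal.generator (codeIdeal C)).leadingCoeff⁻¹

/-- The defining set `Z(C) = {i ∈ {0, …, n - 1} | g(α ^ i) = 0}` of a cyclic code with generator
polynomial `g`, with respect to a (primitive `n`-th root of unity) `α` in an extension of `F`. -/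
def definingSet {F K : Type*} [Field F] [Field K] [Algebra F K] {n : ℕ} (α : K)
    (C : Submodule F (Fin n → F)) : Set (Fin n) :=
  {i | Polynomial.aeval (α ^ (i : ℕ)) (generatorPoly C) = 0}

/-! ## Entanglement-assisted quantum codes

A qudit has state space `ℂ ^ A`, with orthonormal basis indexed by the finite alphabet `A`, so its
dimension is `q = |A|`. A system of `m` qudits has state space `ℂ ^ (Fin m → A)`. -/

/-- The state `|Φ⟩ = q ^ (-c/2) ∑ₐ |a⟩|a⟩`, that is `c` copies of the maximally entangled state of
two qudits. The first factor collects the `c` halves of the sender, the second one those of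
the receiver. -/
def maxEntangled (A : Type*) [Fintype A] [DecidableEq A] (c : ℕ) :
    (Fin c → A) × (Fin c → A) → ℂ :=
  fun p => if p.1 = p.2 then (((Real.sqrt ((Fintype.card A : ℝ) ^ c))⁻¹ : ℝ) : ℂ) else 0

/-- The encoding operation of the sender: an isometry from `k` logical qudits together with the
sender's halves of `c` entangled pairs to `n` physical qudits. (Equivalently: a unitary operator
on `n` qudits, applied to these `k + c` qudits and `n - k - c` ancillas in a fixed state.) -/
structure Encoder (A : Type*) [Fintype A] [DecidableEq A] (n k c : ℕ) where
  V : Matrix (Fin n → A) ((Fin k → A) × (Fin c → A)) ℂ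
  isometry : Vᴴ * V = 1

/-- The encoded state `(V ⊗ 1) (|ψ⟩ ⊗ |Φ⟩)` of a logical state `ψ`. It lives on the `n` physical
qudits and on the `c` qudits that the receiver already holds. -/
def Encoder.encode {A : Type*} [Fintype A] [DecidableEq A] {n k c : ℕ} (U : Encoder A n k c)
    (ψ : (Fin k → A) → ℂ) : (Fin n → A) × (Fin c → A) → ℂ :=
  fun p => ∑ m : Fin k → A, ∑ a : Fin c → A,
    U.V p.1 (m, a) * (ψ m * maxEntangled A c (a, p.2))

/-- The operator `E` on `n` qudits acts only on the qudits in `S`, that is `E = M ⊗ 1` with `M` an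
operator on these qudits. -/
def SupportedOn {A : Type*} [DecidableEq A] {n : ℕ} (S : Finset (Fin n))
    (E : Matrix (Fin n → A) (Fin n → A) ℂ) : Prop :=
  ∃ M : Matrix (S → A) (S → A) ℂ, ∀ x y : Fin n → A,
    E x y = if ∀ i, i ∉ S → x i = y i then M (fun i => x i) (fun i => y i) else 0

/-- The matrix element `⟨enc φ| E ⊗ 1 |enc ψ⟩` of an error `E` on the `n` physical qudits. The
qudits of the receiver are error-free. -/
def Encoder.matElem {A : Type*} [Fintype A] [DecidableEq A] {n k c : ℕ} (U : Encoder A n k c)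
    (E : Matrix (Fin n → A) (Fin n → A) ℂ) (φ ψ : (Fin k → A) → ℂ) : ℂ :=
  star (U.encode φ) ⬝ᵥ ((E ⊗ₖ (1 : Matrix (Fin c → A) (Fin c → A) ℂ)) *ᵥ U.encode ψ)

/-- The code has minimum distance at least `d`: every error that acts on fewer than `d` of the
physical qudits is detectable, by the Knill-Laflamme condition `P (E ⊗ 1) P = λ P` with `P` the
projection onto the code space. In particular `⌊(d - 1) / 2⌋` errors can be corrected. For `k = 0`
this is void (the code space is a line), and one requires, as usual, that the code be pure:
`λ = tr E / q ^ n`. -/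
structure Encoder.DistanceAtLeast {A : Type*} [Fintype A] [DecidableEq A] {n k c : ℕ}
    (U : Encoder A n k c) (d : ℕ) : Prop where
  detects : ∀ S : Finset (Fin n), S.card < d →
    ∀ E : Matrix (Fin n → A) (Fin n → A) ℂ, SupportedOn S E →
      ∃ l : ℂ, ∀ φ ψ : (Fin k → A) → ℂ,
        U.matElem E φ ψ = l * (star (U.encode φ) ⬝ᵥ U.encode ψ)
  pure_of_zero : k = 0 → ∀ S : Finset (Fin n), S.card < d →
    ∀ E : Matrix (Fin n → A) (Fin n → A) ℂ, SupportedOn S E →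
      ∀ φ ψ : (Fin k → A) → ℂ,
        U.matElem E φ ψ =
          E.trace / (Fintype.card A : ℂ) ^ n * (star (U.encode φ) ⬝ᵥ U.encode ψ)

/-- There is an entanglement-assisted quantum code with parameters `[[n, k, d; c]]_q`, `q = |A|`:
it encodes `k` logical qudits into `n` physical qudits with the help of `c` maximally entangled
pairs, and has minimum distance at least `d`. -/
def ExistsCode (A : Type*) [Fintype A] [DecidableEq A] (n k d c : ℕ) : Prop :=
  ∃ U : Encoder A n k c, U.DistanceAtLeast d

end QUENTA

end

namespace QUENTA

/-! ## Averages over finite groups -/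

/-! Put `W = C₁^⊥ ⊓ C₂`, and let `f` and `g` parametrize complements of `W` in `C₂` and in `C₁^⊥`.
The encoder sends `|m⟩|b⟩` to the uniform superposition of the words `f m + g b + w`, `w ∈ W`. The
receiver holds `b` intact, so an error `E` on a set `S` of fewer than `min d₁ d₂` qudits is only
tested between words with the same `b`. A nonzero entry of `E` joins words agreeing off `S`; with
`b` equal, their difference lies in `C₂` and has weight below `d₂`, so they coincide. Only diagonal
entries remain, summed over a translate of `C₁^⊥`. As `S` supports no nonzero word of `C₁`, the code
`C₁^⊥` projects uniformly onto `S`, and the average is `tr E / q ^ n` for every `m`. This one scalar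
gives both detection and purity (`existsCode_of_parametrization`, `existsCode_of_linear_codes`).

Cyclicity enters only through dimensions: `dim C = n - |Z(C)|` and `Z(C₁^⊥ ⊔ C₂) = Z(C₁^⊥) ∩ Z(C₂)`,
which determine `dim W`. -/

theorem card_mul_sum_comp_of_surjective {G H R : Type*} [AddCommGroup G] [Fintype G]
    [AddCommGroup H] [Fintype H] [CommSemiring R] (r : G →+ H) (hr : Function.Surjective r)
    (u : H → R) :
    (Fintype.card H : R) * ∑ p, u (r p) = (Fintype.card G : R) * ∑ z, u z := by
  -- Every translation of `H` lifts to one of `G`; counting the double sum both ways then gives the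
  -- claim.
  have translate (z : H) : ∑ p, u (r p + z) = ∑ p, u (r p) := by
    obtain ⟨g, rfl⟩ := hr z
    simp only [← map_add]
    exact Equiv.sum_comp (Equiv.addRight g) (fun p => u (r p))
  have h : ∑ z : H, ∑ p : G, u (r p + z) = ∑ p : G, ∑ z : H, u (r p + z) := Finset.sum_comm
  have h' (p : G) : ∑ z : H, u (r p + z) = ∑ z, u z :=
    Equiv.sum_comp (Equiv.addLeft (r p)) u
  simpa only [translate, h', Finset.sum_const, Finset.card_univ, nsmul_eq_mul] using h

/-- Restriction of words to a set of coordinates. -/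
def restrictHom (F : Type*) [Field F] {n : ℕ} (S : Finset (Fin n)) :
    (Fin n → F) →ₗ[F] (S → F) := LinearMap.funLeft F F (fun i : S => (i : Fin n))

theorem restrictHom_surjective (F : Type*) [Field F] {n : ℕ} (S : Finset (Fin n)) :
    Function.Surjective (restrictHom F S) :=
  LinearMap.funLeft_surjective_of_injective F F _ Subtype.val_injective

/-- If the words of a set project uniformly onto `S`, the diagonal of an operator supported
on `S` averages over this set, and over its translates, to the normalized trace. -/
theorem SupportedOn.sum_diag {F : Type*} [Field F] [Fintype F] [DecidableEq F] {n : ℕ}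
    {S : Finset (Fin n)} {E : Matrix (Fin n → F) (Fin n → F) ℂ} (hE : SupportedOn S E)
    {G : Type*} [AddCommGroup G] [Fintype G] (r : G →+ (Fin n → F))
    (hr : Function.Surjective fun p => restrictHom F S (r p)) (x : Fin n → F) :
    ∑ p, E (x + r p) (x + r p) =
      (Fintype.card G : ℂ) * (E.trace / (Fintype.card F : ℂ) ^ n) := by
  obtain ⟨M, hM⟩ := hE
  let u : (S → F) → ℂ := fun z => M z z
  have hd (y) : E y y = u (restrictHom F S y) := by simp [hM, u, restrictHom]; rfl
  have hq : (Fintype.card F : ℂ) ≠ 0 := by simp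
  have hS : (Fintype.card (S → F) : ℂ) ≠ 0 := by simp
  have h₁ := card_mul_sum_comp_of_surjective
    ((restrictHom F S).toAddMonoidHom.comp r) hr (fun z => u (restrictHom F S x + z))
  have h₂ := card_mul_sum_comp_of_surjective
    (restrictHom F S).toAddMonoidHom (restrictHom_surjective F S) u
  have ht : ∑ z, u (restrictHom F S x + z) = ∑ z, u z :=
    Equiv.sum_comp (Equiv.addLeft (restrictHom F S x)) u
  rw [ht] at h₁
  have hF : (Fintype.card (Fin n → F) : ℂ) = (Fintype.card F : ℂ) ^ n := by simp
  rw [hF] at h₂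
  have e₁ : ∑ p, E (x + r p) (x + r p) = ∑ p, u (restrictHom F S x +
      ((restrictHom F S).toAddMonoidHom.comp r) p) :=
    Finset.sum_congr rfl fun p _ => by rw [hd, map_add]; rfl
  have e₂ : E.trace = ∑ y, u ((restrictHom F S).toAddMonoidHom y) :=
    Finset.sum_congr rfl fun y _ => hd y
  rw [e₁, e₂]
  apply mul_left_cancel₀ hS
  rw [h₁]
  field_simp
  rw [mul_comm, ← h₂]

/-! ## Encoders from uniform superpositions -/

section Superposition

variable {A W : Type*} [Fintype A] [DecidableEq A] [Fintype W] {n k c : ℕ}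

/-- The column of `p` is the uniform superposition of the basis states `e p w`. -/
noncomputable def superposition (e : (Fin k → A) × (Fin c → A) → W → (Fin n → A)) :
    Matrix (Fin n → A) ((Fin k → A) × (Fin c → A)) ℂ :=
  fun x p => (((Real.sqrt (Fintype.card W : ℝ))⁻¹ : ℝ) : ℂ) * ∑ w, if x = e p w then 1 else 0

theorem ofReal_inv_sqrt_mul_self {r : ℝ} (hr : 0 ≤ r) :
    (((Real.sqrt r)⁻¹ : ℝ) : ℂ) * (((Real.sqrt r)⁻¹ : ℝ) : ℂ) = ((r : ℝ) : ℂ)⁻¹ := by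
  rw [← Complex.ofReal_mul, ← mul_inv, Real.mul_self_sqrt hr, Complex.ofReal_inv]

theorem superposition_sandwich (e : (Fin k → A) × (Fin c → A) → W → (Fin n → A))
    (E : Matrix (Fin n → A) (Fin n → A) ℂ) (p p' : (Fin k → A) × (Fin c → A)) :
    ((superposition e)ᴴ * E * superposition e) p p' =
      (Fintype.card W : ℂ)⁻¹ * ∑ w, ∑ w', E (e p w) (e p' w') := by
  have h := ofReal_inv_sqrt_mul_self (r := (Fintype.card W : ℝ)) (Nat.cast_nonneg _)
  rw [Complex.ofReal_natCast] at h
  rw [← h]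
  simp only [Matrix.mul_apply, Matrix.conjTranspose_apply, superposition, star_mul', star_sum,
    Complex.star_def, Complex.conj_ofReal, apply_ite (starRingEnd ℂ), map_one, map_zero]
  generalize (((Real.sqrt (Fintype.card W : ℝ))⁻¹ : ℝ) : ℂ) = s
  have hx (y : Fin n → A) : ∑ x, (s * ∑ w, if x = e p w then (1 : ℂ) else 0) * E x y =
      s * ∑ w, E (e p w) y := by
    simp only [mul_assoc, ← Finset.mul_sum, Finset.sum_mul, ite_mul, one_mul, zero_mul]
    rw [Finset.sum_comm]
    simp
  simp only [hx]
  have hy (y : Fin n → A) : (s * ∑ w, E (e p w) y) * (s * ∑ w', if y = e p' w' then (1 : ℂ) else 0)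
      = s * s * ∑ w', if y = e p' w' then ∑ w, E (e p w) y else 0 := by
    rw [mul_mul_mul_comm, Finset.mul_sum]
    simp
  simp only [hy, ← Finset.mul_sum]
  rw [Finset.sum_comm]
  simp only [Finset.sum_ite_eq', Finset.mem_univ, if_true]
  rw [Finset.sum_comm]

/-- Joint injectivity makes the basis states in all columns distinct, so the columns are
orthonormal. -/
theorem superposition_isometry [Nonempty W] (e : (Fin k → A) × (Fin c → A) → W → (Fin n → A))
    (he : Function.Injective (Function.uncurry e)) :
    (superposition e)ᴴ * superposition e = 1 := by
  classical
  ext p p'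
  have h := superposition_sandwich e 1 p p'
  rw [Matrix.mul_one] at h
  rw [h]
  have hi (w w') : e p w = e p' w' ↔ p = p' ∧ w = w' := by
    simpa [Prod.ext_iff] using he.eq_iff (a := (p, w)) (b := (p', w'))
  simp only [Matrix.one_apply, hi]
  by_cases hp : p = p' <;> simp [hp]

end Superposition

theorem Encoder.encode_eq {A : Type*} [Fintype A] [DecidableEq A] {n k c : ℕ}
    (U : Encoder A n k c) (ψ : (Fin k → A) → ℂ) (x : Fin n → A) (b : Fin c → A) :
    U.encode ψ (x, b) = (((Real.sqrt ((Fintype.card A : ℝ) ^ c))⁻¹ : ℝ) : ℂ) *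
      ∑ m, U.V x (m, b) * ψ m := by
  simp only [Encoder.encode, maxEntangled, mul_ite, mul_zero, Finset.sum_ite_eq',
    Finset.mem_univ, if_true, Finset.mul_sum]
  exact Finset.sum_congr rfl fun m _ => by ring

/-- The receiver's basis states are orthonormal and untouched, so only blocks with equal `b`
contribute. -/
theorem Encoder.matElem_eq {A : Type*} [Fintype A] [DecidableEq A] {n k c : ℕ}
    (U : Encoder A n k c) (E : Matrix (Fin n → A) (Fin n → A) ℂ) (φ ψ : (Fin k → A) → ℂ) :
    U.matElem E φ ψ = ((Fintype.card A : ℂ) ^ c)⁻¹ *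
      ∑ m, ∑ m', star (φ m) * ψ m' * ∑ b, (U.Vᴴ * E * U.V) (m, b) (m', b) := by
  have h := ofReal_inv_sqrt_mul_self (r := (Fintype.card A : ℝ) ^ c) (by positivity)
  rw [Complex.ofReal_pow, Complex.ofReal_natCast] at h
  rw [← h]
  have hE (x : Fin n → A) (b : Fin c → A) :
      ((E ⊗ₖ (1 : Matrix (Fin c → A) (Fin c → A) ℂ)) *ᵥ U.encode ψ) (x, b) =
        ∑ y, E x y * U.encode ψ (y, b) := by
    simp [Matrix.mulVec, dotProduct, Fintype.sum_prod_type, Matrix.kroneckerMap_apply,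
      Matrix.one_apply]
  have hb (b : Fin c → A) :
      ∑ x, star (∑ m, U.V x (m, b) * φ m) * ∑ y, E x y * ∑ m, U.V y (m, b) * ψ m =
        ∑ m, ∑ m', star (φ m) * ψ m' * (U.Vᴴ * E * U.V) (m, b) (m', b) := by
    let B : Matrix (Fin n → A) (Fin k → A) ℂ := fun x m => U.V x (m, b)
    calc _ = star (B *ᵥ φ) ⬝ᵥ (E *ᵥ (B *ᵥ ψ)) := rfl
      _ = star φ ⬝ᵥ ((Bᴴ * E * B) *ᵥ ψ) := by
        rw [Matrix.star_mulVec, ← Matrix.dotProduct_mulVec, Matrix.mulVec_mulVec,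
          Matrix.mulVec_mulVec, Matrix.mul_assoc]
      _ = ∑ m, ∑ m', star (φ m) * ψ m' * (Bᴴ * E * B) m m' := by
        simp only [dotProduct, Matrix.mulVec, Finset.mul_sum, Pi.star_apply]
        exact Finset.sum_congr rfl fun m _ => Finset.sum_congr rfl fun m' _ => by ring
  simp only [Encoder.matElem, dotProduct, Fintype.sum_prod_type, Pi.star_apply, hE,
    Encoder.encode_eq]
  generalize hs : (((Real.sqrt ((Fintype.card A : ℝ) ^ c))⁻¹ : ℝ) : ℂ) = s
  have hstar : star s = s := by rw [← hs, Complex.star_def, Complex.conj_ofReal]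
  have hx (x : Fin n → A) (b : Fin c → A) :
      star (s * ∑ m, U.V x (m, b) * φ m) * ∑ y, E x y * (s * ∑ m, U.V y (m, b) * ψ m) =
        s * s * (star (∑ m, U.V x (m, b) * φ m) * ∑ y, E x y * ∑ m, U.V y (m, b) * ψ m) := by
    simp only [mul_left_comm _ s, ← Finset.mul_sum, star_mul', hstar]
    ring
  simp only [hx, ← Finset.mul_sum]
  rw [Finset.sum_comm]
  simp only [hb]
  rw [Finset.sum_comm]
  congr 1
  refine Finset.sum_congr rfl fun m _ => ?_
  rw [Finset.sum_comm]
  simp only [Finset.mul_sum]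

/-- An encoder given by an additive parametrization of words whose differences have large weight
and whose ebit and superposition parts project uniformly onto few coordinates. -/
theorem existsCode_of_parametrization {F : Type*} [Field F] [Fintype F] [DecidableEq F]
    {n k c d : ℕ} {W : Type*} [AddCommGroup W] [Fintype W]
    (f : (Fin k → F) → (Fin n → F)) (r : (Fin c → F) × W →+ (Fin n → F))
    (hinj : Function.Injective fun p : (Fin k → F) × ((Fin c → F) × W) => f p.1 + r p.2)
    (hdist : ∀ m m' b w w', hammingDist (f m + r (b, w)) (f m' + r (b, w')) < d →
      f m + r (b, w) = f m' + r (b, w'))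
    (hproj : ∀ S : Finset (Fin n), S.card < d →
      Function.Surjective fun p => restrictHom F S (r p)) :
    ExistsCode F n k d c := by
  classical
  let e : (Fin k → F) × (Fin c → F) → W → (Fin n → F) := fun p w => f p.1 + r (p.2, w)
  have he : Function.Injective (Function.uncurry e) := by
    rintro ⟨⟨m, b⟩, w⟩ ⟨⟨m', b'⟩, w'⟩ h
    have := @hinj (m, (b, w)) (m', (b', w')) h
    simp only [Prod.mk.injEq] at this ⊢
    tauto
  let U : Encoder F n k c := ⟨superposition e, superposition_isometry e he⟩
  have key (S : Finset (Fin n)) (hS : S.card < d) (E : Matrix (Fin n → F) (Fin n → F) ℂ)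
      (hE : SupportedOn S E) (φ ψ : (Fin k → F) → ℂ) :
      U.matElem E φ ψ = E.trace / (Fintype.card F : ℂ) ^ n * ∑ m, star (φ m) * ψ m := by
    have hoff (m m' b w w') (h : E (f m + r (b, w)) (f m' + r (b, w')) ≠ 0) :
        m = m' ∧ w = w' := by
      obtain ⟨M, hM⟩ := hE
      have hagree : ∀ i, i ∉ S → (f m + r (b, w)) i = (f m' + r (b, w')) i := by
        by_contra hcon
        exact h (by rw [hM, if_neg hcon])
      have hlt : hammingDist (f m + r (b, w)) (f m' + r (b, w')) < d := by
        refine lt_of_le_of_lt (Finset.card_le_card fun i hi => ?_) hS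
        by_contra hiS
        exact (Finset.mem_filter.mp hi).2 (hagree i hiS)
      have := @hinj (m, (b, w)) (m', (b, w')) (hdist m m' b w w' hlt)
      simp only [Prod.mk.injEq] at this
      tauto
    have hblock (m m') : ∑ b, (U.Vᴴ * E * U.V) (m, b) (m', b) =
        if m = m' then (Fintype.card F : ℂ) ^ c * (E.trace / (Fintype.card F : ℂ) ^ n)
          else 0 := by
      simp only [U, superposition_sandwich, e]
      split_ifs with hm
      · subst hm
        have hdiag (b w) : ∑ w', E (f m + r (b, w)) (f m + r (b, w')) =
            E (f m + r (b, w)) (f m + r (b, w)) := by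
          refine Finset.sum_eq_single w (fun w' _ hw => ?_) (by simp)
          by_contra h
          exact hw (hoff m m b w w' h).2.symm
        -- What remains is the diagonal of `E` summed over the translate of the image of `r` by `f
        -- m`.
        simp only [hdiag, ← Finset.mul_sum]
        rw [← Fintype.sum_prod_type', hE.sum_diag r (hproj S hS) (f m)]
        have hW : (Fintype.card W : ℂ) ≠ 0 := by simp
        simp only [Fintype.card_prod, Fintype.card_pi_const, Nat.cast_mul, Nat.cast_pow]
        field_simp
      · refine Finset.sum_eq_zero fun b _ => ?_
        rw [Finset.sum_eq_zero, mul_zero]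
        refine fun w _ => Finset.sum_eq_zero fun w' _ => ?_
        by_contra h
        exact hm (hoff m m' b w w' h).1
    have hq : (Fintype.card F : ℂ) ≠ 0 := by simp
    rw [Encoder.matElem_eq]
    simp only [hblock, mul_ite, mul_zero, Finset.sum_ite_eq, Finset.mem_univ, if_true,
      ← Finset.sum_mul]
    field_simp
  -- The Gram form is the case `E = 1`, supported on the empty set; this needs `0 < d`.
  have norm (hd : 0 < d) (φ ψ : (Fin k → F) → ℂ) :
      star (U.encode φ) ⬝ᵥ U.encode ψ = ∑ m, star (φ m) * ψ m := by
    have h1 : SupportedOn (∅ : Finset (Fin n)) (1 : Matrix (Fin n → F) (Fin n → F) ℂ) :=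
      ⟨1, fun x y => by simp [Matrix.one_apply, funext_iff]⟩
    have h := key ∅ (by simpa using hd) 1 h1 φ ψ
    rw [Encoder.matElem, Matrix.one_kronecker_one, Matrix.one_mulVec] at h
    rw [h]
    simp
  refine ⟨U, ⟨fun S hS E hE => ⟨E.trace / (Fintype.card F : ℂ) ^ n, fun φ ψ => ?_⟩,
    fun _ S hS E hE φ ψ => ?_⟩⟩ <;>
  rw [key S hS E hE, norm (by omega)]

/-! ## Dual codes -/

section Dual

variable {F : Type*} [Field F] {n : ℕ}

theorem dual_eq_orthogonal (C : Submodule F (Fin n → F)) :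
    dual C = LinearMap.BilinForm.orthogonal (dotProductBilin F F) C := by
  ext y
  rw [LinearMap.BilinForm.mem_orthogonal_iff]
  rfl

theorem dotProductBilin_isRefl :
    LinearMap.BilinForm.IsRefl (dotProductBilin F F : LinearMap.BilinForm F (Fin n → F)) := by
  intro x y h
  exact (dotProduct_comm y x).trans h

theorem dotProductBilin_nondegenerate :
    LinearMap.BilinForm.Nondegenerate
      (dotProductBilin F F : LinearMap.BilinForm F (Fin n → F)) := by
  constructor
  · exact fun x h => dotProduct_eq_zero x h
  · exact fun x h => dotProduct_eq_zero x fun y => (dotProduct_comm x y).trans (h y)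

theorem dual_dual (C : Submodule F (Fin n → F)) : dual (dual C) = C := by
  rw [dual_eq_orthogonal, dual_eq_orthogonal]
  exact LinearMap.BilinForm.orthogonal_orthogonal dotProductBilin_nondegenerate
    dotProductBilin_isRefl C

theorem finrank_add_finrank_dual (C : Submodule F (Fin n → F)) :
    Module.finrank F C + Module.finrank F (dual C) = n := by
  have h := LinearMap.BilinForm.finrank_orthogonal (dotProductBilin_nondegenerate (F := F)) C
  have hC := Submodule.finrank_le C
  rw [← dual_eq_orthogonal] at h
  simp only [Module.finrank_fin_fun] at h hC
  omega

theorem IsCyclic.dual {C : Submodule F (Fin n → F)} (hC : IsCyclic C) :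
    IsCyclic (dual C) := by
  intro y hy x hx
  have iter (m : ℕ) : (fun i => x (((finRotate n).symm ^ m) i)) ∈ C := by
    induction m with
    | zero => simpa using hx
    | succ m ih =>
      have := hC _ ih
      simpa only [pow_succ, Equiv.Perm.mul_apply] using this
  -- The rotation has finite order, so its inverse is one of its powers and also preserves `C`.
  have hrot : (finRotate n).symm ^ (orderOf (finRotate n).symm - 1) = finRotate n := by
    refine eq_inv_of_mul_eq_one_left (b := (finRotate n).symm) ?_
    rw [← pow_succ, Nat.sub_add_cancel (orderOf_pos _), pow_orderOf_eq_one]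
  have h := hy _ (hrot ▸ iter (orderOf (finRotate n).symm - 1))
  rw [← h]
  simp only [dotProduct]
  rw [← Equiv.sum_comp (finRotate n)]
  simp only [Equiv.symm_apply_apply]

/-- Words of the dual of a code project onto any coordinate set that supports no nonzero word
of the code. -/
theorem restrictHom_dual_surjective [DecidableEq F] {C : Submodule F (Fin n → F)}
    (S : Finset (Fin n)) (hS : ∀ x ∈ C, (∀ i, i ∉ S → x i = 0) → x = 0) :
    Function.Surjective fun y : dual C => restrictHom F S y := by
  by_contra hns
  let r : dual C →ₗ[F] (S → F) := (restrictHom F S).comp (dual C).subtype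
  have hlt : LinearMap.range r < ⊤ := by
    rw [lt_top_iff_ne_top]
    exact fun h => hns (LinearMap.range_eq_top.mp h)
  obtain ⟨φ, hφ, hle⟩ := (LinearMap.range r).exists_le_ker_of_lt_top hlt
  -- A functional killing the projection, extended by zero off `S`, is a word of `C^⊥⊥ = C`
  -- supported on `S`.
  let x : Fin n → F := fun i => if h : i ∈ S then φ (Pi.single ⟨i, h⟩ 1) else 0
  have hdot (y : Fin n → F) : y ⬝ᵥ x = φ (restrictHom F S y) := by
    have : restrictHom F S y = ∑ i : S, y i • (Pi.single i (1 : F) : S → F) := by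
      ext j
      simp [restrictHom, LinearMap.funLeft, Finset.sum_apply, Pi.single_apply]
    rw [this, map_sum]
    simp only [map_smul, smul_eq_mul, dotProduct, x, mul_dite, mul_zero]
    rw [← Finset.sum_subset (Finset.subset_univ S) fun i _ hi => dif_neg hi,
      ← Finset.sum_coe_sort]
    exact Finset.sum_congr rfl fun i _ => dif_pos i.2
  have hx : x ∈ C := by
    rw [← dual_dual C]
    intro y hy
    rw [hdot]
    exact hle ⟨⟨y, hy⟩, rfl⟩
  have hx0 : x = 0 := hS x hx fun i hi => by simp [x, hi]
  refine hφ (LinearMap.ext fun z => ?_)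
  obtain ⟨y, rfl⟩ := restrictHom_surjective F S z
  rw [← hdot, hx0]
  simp

end Dual

/-! ## Defining sets of cyclic codes -/

section Cyclic

open Polynomial

variable {F : Type*} [Field F] {n : ℕ}

/-- The linear map `x ↦ ∑ xᵢ Xⁱ`. -/
noncomputable def wordPolyHom (F : Type*) [Field F] (n : ℕ) : (Fin n → F) →ₗ[F] F[X] :=
  ∑ i : Fin n, (monomial (i : ℕ)).comp (LinearMap.proj i)

theorem wordPolyHom_apply (x : Fin n → F) : wordPolyHom F n x = wordPoly x := by
  simp [wordPolyHom, wordPoly, C_mul_X_pow_eq_monomial]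

theorem wordPolyHom_single (i : Fin n) : wordPolyHom F n (Pi.single i 1) = X ^ (i : ℕ) := by
  rw [wordPolyHom_apply, wordPoly, Finset.sum_eq_single i]
  · simp
  · intro j _ hj
    simp [hj]
  · simp

/-- Reduction modulo `Xⁿ - 1`: the `i`-th entry is the sum of the coefficients whose index is
congruent to `i`. -/
noncomputable def reduceWord (F : Type*) [Field F] (n : ℕ) [NeZero n] : F[X] →ₗ[F] (Fin n → F) :=
  lsum fun m => LinearMap.toSpanSingleton F _ (Pi.single (Fin.ofNat n m) 1)

theorem reduceWord_monomial [NeZero n] (m : ℕ) (a : F) :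
    reduceWord F n (monomial m a) = a • Pi.single (Fin.ofNat n m) 1 := by
  simp [reduceWord, sum_monomial_index]

theorem reduceWord_X_pow [NeZero n] (m : ℕ) :
    reduceWord F n (X ^ m) = Pi.single (Fin.ofNat n m) 1 := by
  rw [X_pow_eq_monomial, reduceWord_monomial, one_smul]

theorem reduceWord_wordPoly [NeZero n] (x : Fin n → F) : reduceWord F n (wordPoly x) = x := by
  have h : (reduceWord F n).comp (wordPolyHom F n) = LinearMap.id := by
    refine LinearMap.pi_ext' fun i => LinearMap.ext_ring ?_
    change reduceWord F n (wordPolyHom F n (Pi.single i 1)) = Pi.single i 1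
    rw [wordPolyHom_single, reduceWord_X_pow, Fin.ofNat_eq_cast, Fin.cast_val_eq_self]
  rw [← wordPolyHom_apply]
  exact LinearMap.congr_fun h x

theorem reduceWord_X_mul [NeZero n] (p : F[X]) :
    reduceWord F n (X * p) = fun i => reduceWord F n p ((finRotate n).symm i) := by
  have h : (reduceWord F n).comp (LinearMap.mulLeft F X) =
      (LinearMap.funLeft F F (finRotate n).symm).comp (reduceWord F n) := by
    refine lhom_ext' fun m => LinearMap.ext_ring ?_
    change reduceWord F n (X * monomial m 1) =
      fun i => reduceWord F n (monomial m 1) ((finRotate n).symm i)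
    rw [X_mul_monomial, reduceWord_monomial, reduceWord_monomial, one_smul, one_smul]
    ext i
    have hm : Fin.ofNat n (m + 1) = finRotate n (Fin.ofNat n m) := by
      rw [finRotate_apply]
      ext
      simp [Fin.val_add]
    rw [hm]
    simp only [Pi.single_apply, Equiv.symm_apply_eq]
  exact LinearMap.congr_fun h p

theorem IsCyclic.reduceWord_mul_mem [NeZero n] {C : Submodule F (Fin n → F)} (hC : IsCyclic C)
    (q : F[X]) {p : F[X]} (hp : reduceWord F n p ∈ C) : reduceWord F n (q * p) ∈ C := by
  have hX (m : ℕ) : reduceWord F n (X ^ m * p) ∈ C := by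
    induction m with
    | zero => simpa using hp
    | succ m ih =>
      rw [pow_succ', mul_assoc, reduceWord_X_mul]
      exact hC _ ih
  induction q using Polynomial.induction_on' with
  | add q r hq hr => rw [add_mul, map_add]; exact C.add_mem hq hr
  | monomial m a =>
    rw [← C_mul_X_pow_eq_monomial, mul_assoc, ← smul_eq_C_mul, map_smul]
    exact C.smul_mem a (hX m)

/-- Cyclicity makes the preimage of `C` under reduction an ideal, and it contains all generators of
`codeIdeal C`. -/
theorem IsCyclic.reduceWord_mem [NeZero n] {C : Submodule F (Fin n → F)} (hC : IsCyclic C)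
    {p : F[X]} (hp : p ∈ codeIdeal C) : reduceWord F n p ∈ C := by
  let J : Ideal F[X] :=
    { carrier := {p | reduceWord F n p ∈ C}
      add_mem' := fun {a b} ha hb => by
        rw [Set.mem_ofPred_eq, map_add]
        exact C.add_mem ha hb
      zero_mem' := by
        rw [Set.mem_ofPred_eq, map_zero]
        exact C.zero_mem
      smul_mem' := fun q _ h => hC.reduceWord_mul_mem q h }
  have hle : codeIdeal C ≤ J := by
    refine Ideal.span_le.mpr (Set.insert_subset ?_ ?_)
    · change reduceWord F n (X ^ n - 1) ∈ C
      rw [map_sub, ← pow_zero X, reduceWord_X_pow, reduceWord_X_pow]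
      simp [Fin.ofNat_eq_cast]
    · rintro _ ⟨x, hx, rfl⟩
      change reduceWord F n (wordPoly x) ∈ C
      rwa [reduceWord_wordPoly]
  exact hle hp

theorem IsCyclic.wordPoly_mem_codeIdeal_iff [NeZero n] {C : Submodule F (Fin n → F)}
    (hC : IsCyclic C) (x : Fin n → F) : wordPoly x ∈ codeIdeal C ↔ x ∈ C :=
  ⟨fun h => by simpa only [reduceWord_wordPoly] using hC.reduceWord_mem h,
    fun h => Ideal.subset_span (Set.mem_insert_of_mem _ ⟨x, h, rfl⟩)⟩

theorem X_pow_sub_one_mem_codeIdeal (C : Submodule F (Fin n → F)) :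
    X ^ n - 1 ∈ codeIdeal C :=
  Ideal.subset_span (Set.mem_insert _ _)

theorem mk_wordPoly_reduceWord [NeZero n] (C : Submodule F (Fin n → F)) (p : F[X]) :
    Ideal.Quotient.mk (codeIdeal C) (wordPoly (reduceWord F n p)) =
      Ideal.Quotient.mk (codeIdeal C) p := by
  let π := (Ideal.Quotient.mkₐ F (codeIdeal C)).toLinearMap
  have hX : Ideal.Quotient.mk (codeIdeal C) X ^ n = 1 := by
    rw [← map_pow, ← sub_eq_zero, ← map_one (Ideal.Quotient.mk (codeIdeal C)), ← map_sub]
    exact Ideal.Quotient.eq_zero_iff_mem.mpr (X_pow_sub_one_mem_codeIdeal C)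
  have h : (π.comp (wordPolyHom F n)).comp (reduceWord F n) = π := by
    refine lhom_ext' fun m => LinearMap.ext_ring ?_
    change Ideal.Quotient.mk (codeIdeal C) (wordPolyHom F n (reduceWord F n (monomial m 1))) =
      Ideal.Quotient.mk (codeIdeal C) (monomial m 1)
    rw [reduceWord_monomial, one_smul, wordPolyHom_single, ← X_pow_eq_monomial, map_pow, map_pow,
      Fin.val_ofNat]
    conv_rhs => rw [← Nat.mod_add_div m n, pow_add, pow_mul, hX, one_pow, mul_one]
  rw [← wordPolyHom_apply]
  exact LinearMap.congr_fun h p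

theorem finrank_quotient_eq_natDegree_generator (I : Ideal F[X]) :
    Module.finrank F (F[X] ⧸ I) = (Submodule.IsPrincipal.generator I).natDegree := by
  -- A free `g` permits substituting for `I`, on which the chosen generator itself depends.
  have (g : F[X]) (hI : I = Ideal.span {g}) : Module.finrank F (F[X] ⧸ I) = g.natDegree := by
    subst hI
    exact finrank_quotient_span_eq_natDegree
  exact this _ (Ideal.span_singleton_generator I).symm

/-- The map `F ^ n → F[X] / codeIdeal C` is onto with kernel `C`; apply rank-nullity. -/
theorem IsCyclic.finrank_add_natDegree [NeZero n] {C : Submodule F (Fin n → F)}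
    (hC : IsCyclic C) :
    Module.finrank F C + (Submodule.IsPrincipal.generator (codeIdeal C)).natDegree = n := by
  let φ : (Fin n → F) →ₗ[F] F[X] ⧸ codeIdeal C :=
    (Ideal.Quotient.mkₐ F (codeIdeal C)).toLinearMap.comp (wordPolyHom F n)
  have hφ (x) : φ x = Ideal.Quotient.mk (codeIdeal C) (wordPoly x) := by
    rw [← wordPolyHom_apply]
    rfl
  have hker : LinearMap.ker φ = C := by
    ext x
    rw [LinearMap.mem_ker, hφ, Ideal.Quotient.eq_zero_iff_mem, hC.wordPoly_mem_codeIdeal_iff]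
  have hrange : LinearMap.range φ = ⊤ := by
    rw [LinearMap.range_eq_top]
    intro y
    obtain ⟨p, rfl⟩ := Ideal.Quotient.mk_surjective y
    exact ⟨reduceWord F n p, by rw [hφ, mk_wordPoly_reduceWord]⟩
  have h := LinearMap.finrank_range_add_finrank_ker φ
  rw [hker, hrange, finrank_top, finrank_quotient_eq_natDegree_generator,
    Module.finrank_fin_fun] at h
  omega

variable {K : Type*} [Field K] [Algebra F K] {α : K}

theorem mem_definingSet_iff_generator (C : Submodule F (Fin n → F)) (i : Fin n) :
    i ∈ definingSet α C ↔
      aeval (α ^ (i : ℕ)) (Submodule.IsPrincipal.generator (codeIdeal C)) = 0 := by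
  simp only [definingSet, generatorPoly, Set.mem_ofPred_eq, map_mul, mul_eq_zero, aeval_C,
    map_eq_zero, inv_eq_zero, leadingCoeff_eq_zero, or_iff_left_iff_imp]
  intro h
  rw [h, map_zero]

/-- The generator vanishes at `α ^ i` exactly when the whole ideal does. As a containment of `C`,
the condition turns sums of codes into intersections. -/
theorem mem_definingSet_iff (hα : α ^ n = 1) (C : Submodule F (Fin n → F)) (i : Fin n) :
    i ∈ definingSet α C ↔
      C ≤ LinearMap.ker ((aeval (R := F) (α ^ (i : ℕ))).toLinearMap.comp (wordPolyHom F n)) := by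
  rw [mem_definingSet_iff_generator]
  have h : codeIdeal C ≤ RingHom.ker (aeval (R := F) (α ^ (i : ℕ))) ↔
      aeval (α ^ (i : ℕ)) (Submodule.IsPrincipal.generator (codeIdeal C)) = 0 := by
    conv_lhs => rw [← Ideal.span_singleton_generator (codeIdeal C)]
    rw [Ideal.span_singleton_le_iff_mem, RingHom.mem_ker]
  rw [← h, codeIdeal, Ideal.span_le, Set.insert_subset_iff, Set.image_subset_iff]
  have hroot : (X ^ n - 1 : F[X]) ∈ RingHom.ker (aeval (R := F) (α ^ (i : ℕ))) := by
    rw [RingHom.mem_ker, map_sub, map_pow, aeval_X, map_one, ← pow_mul, mul_comm, pow_mul, hα,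
      one_pow, sub_self]
  rw [SetLike.mem_coe, and_iff_right hroot]
  refine forall₂_congr fun x _ => ?_
  change aeval _ (wordPoly x) = 0 ↔ aeval _ (wordPolyHom F n x) = 0
  rw [wordPolyHom_apply]

theorem definingSet_sup (hα : α ^ n = 1) (C D : Submodule F (Fin n → F)) :
    definingSet α (C ⊔ D) = definingSet α C ∩ definingSet α D := by
  ext i
  rw [Set.mem_inter_iff, mem_definingSet_iff hα, mem_definingSet_iff hα, mem_definingSet_iff hα,
    sup_le_iff]

theorem IsCyclic.sup {C D : Submodule F (Fin n → F)} (hC : IsCyclic C) (hD : IsCyclic D) :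
    IsCyclic (C ⊔ D) := by
  intro x hx
  obtain ⟨y, hy, z, hz, rfl⟩ := Submodule.mem_sup.mp hx
  exact Submodule.mem_sup.mpr ⟨_, hC y hy, _, hD z hz, rfl⟩

/-- The generator divides `X ^ n - 1`, which is separable and splits over `K` with the powers of `α`
as roots. -/
theorem ncard_definingSet [NeZero n] (hα : IsPrimitiveRoot α n) (C : Submodule F (Fin n → F)) :
    (definingSet α C).ncard = (Submodule.IsPrincipal.generator (codeIdeal C)).natDegree := by
  classical
  set g := Submodule.IsPrincipal.generator (codeIdeal C) with hg
  have hdvd : g ∣ X ^ n - Polynomial.C 1 := by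
    rw [C_1, hg, ← Ideal.mem_span_singleton, Ideal.span_singleton_generator]
    exact X_pow_sub_one_mem_codeIdeal C
  have hX : (X ^ n - Polynomial.C 1 : F[X]) ≠ 0 := X_pow_sub_C_ne_zero (NeZero.pos n) 1
  -- A primitive `n`-th root of unity in `K` already forces `n ≠ 0` there.
  have hnF : (n : F) ≠ 0 := by
    have := hα.neZero'.out
    rwa [← map_natCast (algebraMap F K), Ne, map_eq_zero] at this
  have hsep : g.Separable := (separable_X_pow_sub_C 1 hnF one_ne_zero).of_dvd hdvd
  have hsplit : (g.map (algebraMap F K)).Splits := by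
    refine (X_pow_sub_one_splits hα).of_dvd (X_pow_sub_C_ne_zero (NeZero.pos n) 1) ?_
    simpa using map_dvd (algebraMap F K) hdvd
  rw [← card_rootSet_eq_natDegree hsep hsplit, ← Nat.card_eq_fintype_card, Nat.card_coe_set_eq]
  have hinj : Function.Injective fun i : Fin n => α ^ (i : ℕ) := fun i j h =>
    Fin.ext (hα.pow_inj i.2 j.2 h)
  rw [← Set.ncard_image_of_injective _ hinj]
  congr 1
  ext β
  have hg0 : g ≠ 0 := ne_zero_of_dvd_ne_zero hX hdvd
  simp only [Set.mem_image, mem_definingSet_iff_generator, mem_rootSet_of_ne hg0]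
  constructor
  · rintro ⟨i, hi, rfl⟩
    exact hi
  · intro hβ
    have h1 : β ^ n = 1 := by
      have := aeval_eq_zero_of_dvd_aeval_eq_zero hdvd hβ
      simpa [sub_eq_zero] using this
    obtain ⟨i, hi, rfl⟩ := hα.eq_pow_of_pow_eq_one h1
    exact ⟨⟨i, hi⟩, hβ, rfl⟩

theorem IsCyclic.finrank_add_ncard_definingSet [NeZero n] (hα : IsPrimitiveRoot α n)
    {C : Submodule F (Fin n → F)} (hC : IsCyclic C) :
    Module.finrank F C + (definingSet α C).ncard = n := by
  rw [ncard_definingSet hα, hC.finrank_add_natDegree]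

end Cyclic

/-! ## The code of a pair of linear codes -/

theorem exists_complement_parametrization {F V : Type*} [Field F] [AddCommGroup V] [Module F V]
    [FiniteDimensional F V] {W D : Submodule F V} (h : W ≤ D) :
    ∃ f : (Fin (Module.finrank F D - Module.finrank F W) → F) →ₗ[F] V,
      Function.Injective f ∧ Disjoint (LinearMap.range f) W ∧ LinearMap.range f ⊔ W = D := by
  obtain ⟨Q, hQ⟩ := W.exists_isCompl
  -- Modular law: intersecting a complement of `W` with `D` gives a complement inside `D`.
  have hsup : (D ⊓ Q) ⊔ W = D := by
    rw [sup_comm, inf_comm, ← sup_inf_assoc_of_le _ h, hQ.sup_eq_top, top_inf_eq]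
  have hdisj : Disjoint (D ⊓ Q) W := hQ.disjoint.symm.mono_left inf_le_right
  have hfin := Submodule.finrank_sup_add_finrank_inf_eq (D ⊓ Q) W
  rw [hsup, hdisj.eq_bot, finrank_bot, add_zero] at hfin
  let e : (Fin (Module.finrank F D - Module.finrank F W) → F) ≃ₗ[F] (D ⊓ Q : Submodule F V) :=
    LinearEquiv.ofFinrankEq _ _ (by rw [Module.finrank_fin_fun]; omega)
  have hr : LinearMap.range ((D ⊓ Q).subtype.comp e.toLinearMap) = D ⊓ Q := by
    rw [LinearMap.range_comp_of_range_eq_top _ e.range, Submodule.range_subtype]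
  exact ⟨(D ⊓ Q).subtype.comp e.toLinearMap,
    (Submodule.injective_subtype _).comp e.injective, by rwa [hr], by rwa [hr]⟩

theorem HasParams.eq_of_hammingDist_lt {F : Type*} [Field F] [DecidableEq F] {n k d : ℕ}
    {C : Submodule F (Fin n → F)} (hC : HasParams C k d) {x y : Fin n → F} (hx : x ∈ C)
    (hy : y ∈ C) (h : hammingDist x y < d) : x = y := by
  by_contra hne
  exact absurd (hC.minDist.2 ⟨x, hx, y, hy, hne, rfl⟩) (not_le.mpr h)

/-- The CSS-like construction with entanglement: two linear codes `C₁` and `C₂` give a code whose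
numbers of logical qudits and of entangled pairs are `dim C₂ - dim (C₁^⊥ ⊓ C₂)` and
`dim C₁^⊥ - dim (C₁^⊥ ⊓ C₂)`. -/
theorem existsCode_of_linear_codes {F : Type*} [Field F] [Fintype F] [DecidableEq F]
    {n k₁ d₁ k₂ d₂ : ℕ} {C₁ C₂ : Submodule F (Fin n → F)}
    (h₁ : HasParams C₁ k₁ d₁) (h₂ : HasParams C₂ k₂ d₂) :
    ExistsCode F n
      (Module.finrank F C₂ - Module.finrank F (dual C₁ ⊓ C₂ : Submodule F (Fin n → F)))
      (min d₁ d₂)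
      (Module.finrank F (dual C₁) -
        Module.finrank F (dual C₁ ⊓ C₂ : Submodule F (Fin n → F))) := by
  classical
  have := Fintype.ofFinite (dual C₁ ⊓ C₂ : Submodule F (Fin n → F))
  obtain ⟨f, hf, hfd, hfs⟩ :=
    exists_complement_parametrization (inf_le_right : dual C₁ ⊓ C₂ ≤ C₂)
  obtain ⟨g, hg, hgd, hgs⟩ :=
    exists_complement_parametrization (inf_le_left : dual C₁ ⊓ C₂ ≤ dual C₁)
  let r := g.coprod (dual C₁ ⊓ C₂).subtype
  have hr : LinearMap.range r = dual C₁ := by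
    rw [LinearMap.range_coprod, Submodule.range_subtype, hgs]
  have hrinj : Function.Injective r :=
    LinearMap.ker_eq_bot.mp <| by
      rw [LinearMap.ker_coprod_of_disjoint_range _ _ (by rwa [Submodule.range_subtype]),
        LinearMap.ker_eq_bot.mpr hg, Submodule.ker_subtype, Submodule.prod_bot]
  have hfC (m) : f m ∈ C₂ := hfs.le (Submodule.mem_sup_left ⟨m, rfl⟩)
  -- A common element lies in both `C₂` and `C₁^⊥`, hence in `W`, which meets the range of `f`
  -- trivially.
  have hdisj : Disjoint (LinearMap.range f) (LinearMap.range r) := by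
    rw [Submodule.disjoint_def] at hfd ⊢
    rintro _ ⟨m, rfl⟩ hm
    exact hfd _ ⟨m, rfl⟩ ⟨hr.le hm, hfC m⟩
  refine existsCode_of_parametrization f r.toAddMonoidHom ?_ ?_ ?_
  · have hinj : Function.Injective (f.coprod r) :=
      LinearMap.ker_eq_bot.mp <| by
        rw [LinearMap.ker_coprod_of_disjoint_range _ _ hdisj, LinearMap.ker_eq_bot.mpr hf,
          LinearMap.ker_eq_bot.mpr hrinj, Submodule.prod_bot]
    exact hinj
  · intro m m' b w w' h
    -- The part `g b` need not lie in `C₂`, but it cancels from the distance.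
    have hsplit (m w) : f m + r (b, w) = (f m + (w : Fin n → F)) + g b := by
      simp only [r, LinearMap.coprod_apply, Submodule.subtype_apply]
      abel
    change hammingDist (f m + r (b, w)) (f m' + r (b, w')) < _ at h
    change f m + r (b, w) = f m' + r (b, w')
    rw [hsplit, hsplit] at h ⊢
    rw [hammingDist_eq_hammingNorm, neg_add_eq_sub, add_sub_add_right_eq_sub, ← neg_add_eq_sub,
      ← hammingDist_eq_hammingNorm] at h
    rw [h₂.eq_of_hammingDist_lt (C₂.add_mem (hfC m) w.2.2) (C₂.add_mem (hfC m') w'.2.2)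
      (h.trans_le (min_le_right _ _))]
  · intro S hS z
    have hsupp : ∀ x ∈ C₁, (∀ i, i ∉ S → x i = 0) → x = 0 := by
      intro x hx h0
      refine h₁.eq_of_hammingDist_lt hx C₁.zero_mem ((Finset.card_le_card fun i hi => ?_).trans_lt
        (hS.trans_le (min_le_left _ _)))
      by_contra hiS
      exact (Finset.mem_filter.mp hi).2 (h0 i hiS)
    obtain ⟨⟨y, hy⟩, rfl⟩ := restrictHom_dual_surjective S hsupp z
    obtain ⟨p, rfl⟩ := hr.ge hy
    exact ⟨p, rfl⟩

end QUENTA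

/-! ### The parameters in terms of defining sets -/

theorem mainTheorem1 {F : Type*} [Field F] [Fintype F] [DecidableEq F]
    {K : Type*} [Field K] [Algebra F K]
    (n k₁ d₁ k₂ d₂ : ℕ) (hn : Nat.Coprime n (Fintype.card F))
    (α : K) (hα : IsPrimitiveRoot α n)
    (C₁ C₂ : Submodule F (Fin n → F))
    (hC₁ : QUENTA.IsCyclic C₁) (hC₂ : QUENTA.IsCyclic C₂)
    (hP₁ : QUENTA.HasParams C₁ k₁ d₁) (hP₂ : QUENTA.HasParams C₂ k₂ d₂) :
    ∃ k c : ℕ,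
      (k : ℤ) = k₁ -
        (QUENTA.definingSet α (QUENTA.dual C₁) ∩ QUENTA.definingSet α C₂).ncard ∧
      (c : ℤ) = n - k₂ -
        (QUENTA.definingSet α (QUENTA.dual C₁) ∩ QUENTA.definingSet α C₂).ncard ∧
      QUENTA.ExistsCode F n k (min d₁ d₂) c := by
  -- For `n = 0` the gcd would be `q > 1`.
  have : NeZero n := ⟨by
    rintro rfl
    exact Fintype.one_lt_card.ne' ((Nat.coprime_zero_left _).mp hn)⟩
  refine ⟨_, _, ?_, ?_, QUENTA.existsCode_of_linear_codes hP₁ hP₂⟩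
  all_goals
    -- With `z` the size of the intersection, `dim (C₁^⊥ ⊔ C₂) = n - z`, so `dim (C₁^⊥ ⊓ C₂) = k₂ -
    -- k₁ + z`. The bounds `hle₁` and `hle₂` make the natural subtractions exact.
    have hZ := (hC₁.dual.sup hC₂).finrank_add_ncard_definingSet hα
    rw [QUENTA.definingSet_sup hα.pow_eq_one] at hZ
    have hsup := Submodule.finrank_sup_add_finrank_inf_eq (QUENTA.dual C₁) C₂
    have hdual := QUENTA.finrank_add_finrank_dual C₁
    have hle₁ := Submodule.finrank_mono (inf_le_left : QUENTA.dual C₁ ⊓ C₂ ≤ QUENTA.dual C₁)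
    have hle₂ := Submodule.finrank_mono (inf_le_right : QUENTA.dual C₁ ⊓ C₂ ≤ C₂)
    have hk₁ := hP₁.finrank_eq
    have hk₂ := hP₂.finrank_eq
    omega
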